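/- All graphs are finite and simple. For graphs $G$ and $F$, let $N(G,F)$ denote the number of labeled copies of $F$ in $G$, i.e. the number of injections $\phi: V(F)\to V(G)$ such that $\phi(x)\phi(y)\in E(G)$ for every $xy\in E(F)$. For integers $d\ge 1$ and $n>2d$, let $H_{n,d}$ be the $n$-vertex graph obtained from a complete graph $K_{n-d}$ by choosing a set $S$ of $d$ of its vertices and adding $d$ new, pairwise nonadjacent vertices, each of which is adjacent exactly to the vertices of $S$. **Theorem 2.1.** Let $F$ be any graph with $t:=|V(F)|\geq 3$ vertices, let $d\geq 1$ be an integer, and let $n \geq 4dt+3d^2+5t$. If $G$ is an $n$-vertex nonhamiltonian graph with minimum degree $\delta(G)\geq d$, then $N(G,F)\leq N(H_{n,d},F)$. -/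

import Mathlib

/-- The graph `H_{n,d}` on the vertex set `{0, …, n - 1}` (meant for `2 * d < n`).
The vertices `v` with `v + d < n` form the clique `A` of order `n - d`; each of the `d`
remaining vertices is adjacent exactly to the `d` vertices `0, …, d - 1` of `A`. -/
def extremalGraph (n d : ℕ) : SimpleGraph (Fin n) where
  Adj u v := u ≠ v ∧
    (((u : ℕ) + d < n ∧ (v : ℕ) + d < n) ∨
      ((u : ℕ) < d ∧ n ≤ (v : ℕ) + d) ∨
      ((v : ℕ) < d ∧ n ≤ (u : ℕ) + d))
  symm := ⟨by
    rintro u v ⟨huv, h⟩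
    refine ⟨huv.symm, ?_⟩
    rcases h with ⟨hu, hv⟩ | h | h
    · exact Or.inl ⟨hv, hu⟩
    · exact Or.inr (Or.inr h)
    · exact Or.inr (Or.inl h)⟩
  loopless := ⟨fun _ h => h.1 rfl⟩

/-! Adding edges only creates copies, so `G` may be taken edge-maximal nonhamiltonian. By the
crossing argument, nonadjacent vertices then have degree sum below `n`, and Chvátal's extremal
choice of a nonadjacent pair gives some `r` with `d ≤ r < n/2` and at least `r` vertices of degree
at most `r`.

If some `r > d` has this property, crude counting suffices
(`card_copyEmbeddings_le_of_card_degree_le`). Let `D` consist of `r` such vertices and `X` of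
non-isolated vertices of `F`. A copy either sends `X` off `D`, or sends some `x ∈ X` to one of `r`
vertices and a neighbour of `x` to one of at most `r` others. The size of `X` is chosen according to
`r`, and the total is at most the number of maps placing all non-isolated vertices of `F` in the big
clique of `H_{n,d}`.

Otherwise `G` is almost `H_{n,d}`: the set `D` of vertices of degree `d` has exactly `d` elements,
the other vertices form a clique, and all of `D` has the same outside neighbourhood `B`. Only copies
with an edge inside `D` can fail to be copies in the extremal graph;
`card_copyEmbeddings_le_cliqueWithTwins` pays for them with copies that send one vertex to `D` and a
neighbour of it to `S \ B`. -/

/-! ### Counting embeddings with prescribed values -/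

open Finset in
/-- The embeddings of `W` in `V` that extend a fixed embedding `α` of `K` and that send the other
vertices outside a set `E` containing the range of `α`. -/
theorem card_embedding_extend {W V : Type*} [Fintype W] [DecidableEq W] [Fintype V] [DecidableEq V]
    (K : Finset W) (α : K ↪ V) (E : Finset V) (hE : ∀ k, α k ∈ E) :
    #{φ : W ↪ V | (∀ k : K, φ k = α k) ∧ ∀ w ∉ K, φ w ∉ E}
      = (Fintype.card V - #E).descFactorial (Fintype.card W - #K) := by
  classical
  have h1 : Fintype.card ({w // w ∉ K} ↪ {v // v ∉ E})
      = (Fintype.card V - #E).descFactorial (Fintype.card W - #K) := by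
    rw [Fintype.card_embedding_eq]
    congr 1 <;> simp [Fintype.card_subtype_compl]
  rw [← h1, ← Fintype.card_subtype]
  let glue (ψ : {w // w ∉ K} ↪ {v // v ∉ E}) (w : W) : V :=
    if h : w ∈ K then α ⟨w, h⟩ else ψ ⟨w, h⟩
  have glue_mem (ψ) {w} (h : w ∈ K) : glue ψ w = α ⟨w, h⟩ := dif_pos h
  have glue_not_mem (ψ) {w} (h : w ∉ K) : glue ψ w = ψ ⟨w, h⟩ := dif_neg h
  have glue_inj (ψ) : Function.Injective (glue ψ) := by
    intro a b hab
    by_cases ha : a ∈ K <;> by_cases hb : b ∈ K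
    · rw [glue_mem ψ ha, glue_mem ψ hb] at hab
      exact congrArg Subtype.val (α.injective hab)
    · rw [glue_mem ψ ha, glue_not_mem ψ hb] at hab
      exact absurd (hab ▸ hE ⟨a, ha⟩) (ψ ⟨b, hb⟩).2
    · rw [glue_not_mem ψ ha, glue_mem ψ hb] at hab
      exact absurd (hab ▸ hE ⟨b, hb⟩) (ψ ⟨a, ha⟩).2
    · rw [glue_not_mem ψ ha, glue_not_mem ψ hb] at hab
      exact congrArg Subtype.val (ψ.injective (Subtype.ext hab))
  exact Fintype.card_congr
    { toFun := fun φ => ⟨fun w => ⟨φ.1 w, φ.2.2 w w.2⟩, fun a b h =>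
        Subtype.ext (φ.1.injective (congrArg Subtype.val h))⟩
      invFun := fun ψ => ⟨⟨glue ψ, glue_inj ψ⟩, fun k => glue_mem ψ k.2, fun w hw h =>
        (ψ ⟨w, hw⟩).2 (glue_not_mem ψ hw ▸ h)⟩
      left_inv := fun φ => Subtype.ext <| Function.Embedding.ext fun w => by
        by_cases h : w ∈ K
        · exact (glue_mem _ h).trans (φ.2.1 ⟨w, h⟩).symm
        · exact glue_not_mem _ h
      right_inv := fun ψ => Function.Embedding.ext fun w => Subtype.ext (glue_not_mem ψ w.2) }

-- Grouping the embeddings by their restriction to `K` reduces this to a fixed restriction; the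
-- forbidden set may depend on it.
open Finset in
theorem card_embedding_extend_family {W V : Type*} [Fintype W] [DecidableEq W] [Fintype V]
    [DecidableEq V] (K : Finset W) (A : Finset (K ↪ V)) (E : (K ↪ V) → Finset V)
    (hE : ∀ α k, α k ∈ E α) :
    #{φ : W ↪ V | (Function.Embedding.subtype (· ∈ K)).trans φ ∈ A ∧
        ∀ w ∉ K, φ w ∉ E ((Function.Embedding.subtype (· ∈ K)).trans φ)}
      = ∑ α ∈ A, (Fintype.card V - #(E α)).descFactorial (Fintype.card W - #K) := by
  classical
  rw [Finset.card_eq_sum_card_fiberwise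
    (f := fun φ : W ↪ V => (Function.Embedding.subtype (· ∈ K)).trans φ) (t := A)]
  · refine Finset.sum_congr rfl fun α hα => ?_
    rw [← card_embedding_extend K α (E α) (hE α)]
    congr 1
    ext φ
    simp only [mem_filter, mem_univ, true_and]
    constructor
    · rintro ⟨⟨-, h⟩, rfl⟩
      exact ⟨fun k => rfl, h⟩
    · rintro ⟨h1, h2⟩
      have : (Function.Embedding.subtype (· ∈ K)).trans φ = α := by
        ext k; exact h1 k
      exact ⟨⟨this ▸ hα, this ▸ h2⟩, this⟩
  · intro φ hφ
    simp only [coe_filter, mem_univ, true_and, Set.mem_ofPred_eq] at hφ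
    exact hφ.1

open Finset in
theorem card_embedding_avoiding {W V : Type*} [Fintype W] [DecidableEq W] [Fintype V]
    [DecidableEq V] (X : Finset W) (D : Finset V) :
    #{φ : W ↪ V | ∀ x ∈ X, φ x ∉ D}
      = (Fintype.card V - #D).descFactorial #X *
        (Fintype.card V - #X).descFactorial (Fintype.card W - #X) := by
  classical
  have h := card_embedding_extend_family X {α : X ↪ V | ∀ x, α x ∉ D}
    (fun α => univ.image α) (by simp)
  have h2 : #{α : X ↪ V | ∀ x, α x ∉ D} = (Fintype.card V - #D).descFactorial #X := by
    have h4 := card_embedding_extend (∅ : Finset X) (Function.Embedding.ofIsEmpty) D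
      (fun x => absurd x.2 (Finset.notMem_empty _))
    simpa using h4
  rw [sum_congr rfl (g := fun _ => (Fintype.card V - #X).descFactorial (Fintype.card W - #X)),
    sum_const, h2, smul_eq_mul] at h
  · rw [← h]
    congr 1
    ext φ
    simp
  · intro α _
    rw [card_image_of_injective _ α.injective]
    simp

open Finset in
theorem card_embedding_pair {W V : Type*} [Fintype W] [DecidableEq W] [Fintype V]
    [DecidableEq V] {x y : W} (hxy : x ≠ y) (u v : V) :
    #{φ : W ↪ V | φ x = u ∧ φ y = v} ≤ (Fintype.card V - 2).descFactorial (Fintype.card W - 2) := by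
  classical
  have h := card_embedding_extend_family {x, y} {α : ({x, y} : Finset W) ↪ V | α ⟨x, by simp⟩ = u ∧ α ⟨y, by simp⟩ = v}
    (fun α => univ.image α) (by simp)
  rw [sum_congr rfl (g := fun _ => (Fintype.card V - 2).descFactorial (Fintype.card W - 2)),
    sum_const, smul_eq_mul] at h
  · have h2 : #{α : ({x, y} : Finset W) ↪ V | α ⟨x, by simp⟩ = u ∧ α ⟨y, by simp⟩ = v} ≤ 1 := by
      refine card_le_one.2 fun α hα β hβ => ?_
      simp only [mem_filter, mem_univ, true_and] at hα hβ
      ext ⟨k, hk⟩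
      simp only [mem_insert, mem_singleton] at hk
      rcases hk with rfl | rfl
      · exact hα.1.trans hβ.1.symm
      · exact hα.2.trans hβ.2.symm
    calc _ = _ := ?_
      _ ≤ _ := h.le.trans (Nat.mul_le_mul_right _ h2)
      _ = _ := one_mul _
    congr 1
    ext φ
    simp
    rintro rfl rfl w h1 h2
    exact ⟨h1, fun h => h2 h.symm⟩
  · intro α _
    rw [card_image_of_injective _ α.injective]
    rw [card_univ, Fintype.card_coe, card_pair hxy]

/-! ### Labelled copies and the two basic counting bounds -/

namespace SimpleGraph

open Finset

set_option linter.unusedSectionVars false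
variable {W V : Type*} [Fintype W] [DecidableEq W] [Fintype V] [DecidableEq V]

open Classical in
/-- The labelled copies of `F` in `G`, as embeddings of vertex types. -/
noncomputable def copyEmbeddings (F : SimpleGraph W) (G : SimpleGraph V) : Finset (W ↪ V) :=
  {φ | ∀ x y, F.Adj x y → G.Adj (φ x) (φ y)}

theorem mem_copyEmbeddings {F : SimpleGraph W} {G : SimpleGraph V} {φ : W ↪ V} :
    φ ∈ copyEmbeddings F G ↔ ∀ x y, F.Adj x y → G.Adj (φ x) (φ y) := by
  simp [copyEmbeddings]

theorem labelledCopyCount_eq_card_copyEmbeddings (F : SimpleGraph W) (G : SimpleGraph V) :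
    G.labelledCopyCount F = #(copyEmbeddings F G) := by
  classical
  have h : G.labelledCopyCount F = Nat.card (Copy F G) := by
    unfold labelledCopyCount
    exact Fintype.card_eq_nat_card
  have h2 : #(copyEmbeddings F G) = Nat.card (copyEmbeddings F G) := by simp
  rw [h, h2]
  exact Nat.card_congr
    { toFun := fun c => ⟨⟨c.toHom, c.injective'⟩, mem_copyEmbeddings.2 fun x y h => c.toHom.map_adj h⟩
      invFun := fun φ => ⟨⟨φ.1, fun h => mem_copyEmbeddings.1 φ.2 _ _ h⟩, φ.1.injective⟩
      left_inv := fun c => rfl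
      right_inv := fun φ => rfl }

theorem copyEmbeddings_mono (F : SimpleGraph W) {G G' : SimpleGraph V} (h : G ≤ G') :
    copyEmbeddings F G ⊆ copyEmbeddings F G' := fun _ hφ =>
  mem_copyEmbeddings.2 fun x y hxy => h (mem_copyEmbeddings.1 hφ x y hxy)

theorem card_copyEmbeddings_iso {V' : Type*} [Fintype V'] [DecidableEq V'] (F : SimpleGraph W)
    {G : SimpleGraph V} {G' : SimpleGraph V'} (e : G ≃g G') :
    #(copyEmbeddings F G) = #(copyEmbeddings F G') := by
  refine card_bij' (fun φ _ => φ.trans e.toEquiv.toEmbedding)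
    (fun φ _ => φ.trans e.symm.toEquiv.toEmbedding) ?_ ?_ ?_ ?_
  · intro φ hφ
    exact mem_copyEmbeddings.2 fun x y h => e.map_adj_iff.2 (mem_copyEmbeddings.1 hφ x y h)
  · intro φ hφ
    exact mem_copyEmbeddings.2 fun x y h => e.symm.map_adj_iff.2 (mem_copyEmbeddings.1 hφ x y h)
  · intro φ _; ext x; simp
  · intro φ _; ext x; simp

/-- If the vertices of `D` have degree at most `r`, a copy of `F` either avoids `D` on a given set
`X` of non-isolated vertices, or maps some `x ∈ X` into `D` and a neighbour of `x` to one of at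
most `r` vertices. -/
theorem card_copyEmbeddings_le (F : SimpleGraph W) (G : SimpleGraph V) [DecidableRel G.Adj]
    (X : Finset W) (hX : ∀ x ∈ X, ∃ y, F.Adj x y) (D : Finset V) (r : ℕ) (hD : #D = r)
    (hdeg : ∀ v ∈ D, G.degree v ≤ r) :
    #(copyEmbeddings F G) ≤
      (Fintype.card V - r).descFactorial #X *
        (Fintype.card V - #X).descFactorial (Fintype.card W - #X) +
      #X * (r * r * (Fintype.card V - 2).descFactorial (Fintype.card W - 2)) := by
  classical
  choose! y hy using hX
  have hsub : copyEmbeddings F G ⊆ ({φ : W ↪ V | ∀ x ∈ X, φ x ∉ D} : Finset _) ∪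
      X.biUnion fun x => D.biUnion fun u => (G.neighborFinset u).biUnion fun v =>
        ({φ : W ↪ V | φ x = u ∧ φ (y x) = v} : Finset _) := by
    intro φ hφ
    rw [mem_copyEmbeddings] at hφ
    by_cases h : ∀ x ∈ X, φ x ∉ D
    · exact mem_union_left _ (mem_filter.2 ⟨mem_univ _, h⟩)
    · push Not at h
      obtain ⟨x, hx, hxD⟩ := h
      refine mem_union_right _ ?_
      simp only [mem_biUnion, mem_filter, mem_univ, true_and, mem_neighborFinset]
      exact ⟨x, hx, φ x, hxD, φ (y x), hφ _ _ (hy x hx), rfl, rfl⟩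
  refine (card_le_card hsub).trans ((card_union_le _ _).trans (Nat.add_le_add ?_ ?_))
  · rw [card_embedding_avoiding, hD]
  · refine card_biUnion_le_card_mul _ _ _ fun x hx => ?_
    rw [mul_assoc]
    nth_rewrite 1 [← hD]
    refine card_biUnion_le_card_mul _ _ _ fun u hu => ?_
    refine (card_biUnion_le_card_mul _ _ _ fun v _ => card_embedding_pair (hy x hx).ne u v).trans ?_
    exact Nat.mul_le_mul_right _ (by simpa using hdeg u hu)

/-- Copies of `F` all of whose non-isolated vertices lie in a clique. -/
theorem le_card_copyEmbeddings (F : SimpleGraph W) (G : SimpleGraph V) (T : Finset W)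
    (hT : ∀ x y, F.Adj x y → x ∈ T) (D : Finset V)
    (hG : ∀ u ∉ D, ∀ v ∉ D, u ≠ v → G.Adj u v) :
    (Fintype.card V - #D).descFactorial #T *
        (Fintype.card V - #T).descFactorial (Fintype.card W - #T) ≤ #(copyEmbeddings F G) := by
  classical
  rw [← card_embedding_avoiding]
  refine card_le_card fun φ hφ => mem_copyEmbeddings.2 fun x y h => ?_
  simp only [mem_filter, mem_univ, true_and] at hφ
  exact hG _ (hφ x (hT x y h)) _ (hφ y (hT y x h.symm)) (φ.injective.ne h.ne)

end SimpleGraph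

/-! ### Inequalities for falling factorials -/

namespace Nat

theorem succ_descFactorial_succ_eq_add (a k : ℕ) :
    (a + 1).descFactorial (k + 1) = a.descFactorial (k + 1) + (k + 1) * a.descFactorial k := by
  rw [succ_descFactorial_succ, descFactorial_succ]
  rcases le_or_gt k a with h | h
  · rw [← add_mul]
    congr 1
    lia
  · simp [descFactorial_eq_zero_iff_lt.2 h]

theorem descFactorial_add_mul_le (a j k : ℕ) :
    a.descFactorial (k + 1) + j * ((k + 1) * a.descFactorial k) ≤
      (a + j).descFactorial (k + 1) := by
  induction j with
  | zero => simp
  | succ j ih =>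
    rw [← add_assoc, succ_descFactorial_succ_eq_add, add_mul, one_mul]
    have := Nat.mul_le_mul_left (k + 1) (descFactorial_le k (le_add_right a j))
    lia

theorem descFactorial_le_add_mul (N s k : ℕ) (hs : s ≤ N) :
    N.descFactorial (k + 1) ≤
      (N - s).descFactorial (k + 1) + s * ((k + 1) * (N - 1).descFactorial k) := by
  induction s with
  | zero => simp
  | succ s ih =>
    have h := succ_descFactorial_succ_eq_add (N - (s + 1)) k
    rw [show N - (s + 1) + 1 = N - s by lia] at h
    have := Nat.mul_le_mul_left (k + 1)
      (descFactorial_le k (show N - (s + 1) ≤ N - 1 by lia))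
    have := ih (by lia)
    rw [add_mul, one_mul]
    lia

/-- Division-free form of `(N - s)_k / N_k ≥ 1 - s * k / N`, the union bound for a random injection
of `k` points hitting `s` given ones. -/
theorem mul_descFactorial_le (N s k : ℕ) (hs : s ≤ N) :
    N * N.descFactorial k ≤ N * (N - s).descFactorial k + s * k * N.descFactorial k := by
  rcases k with _ | k
  · simp
  rcases N with _ | N
  · simp
  have h := Nat.mul_le_mul_left (N + 1) (descFactorial_le_add_mul (N + 1) s k hs)
  refine h.trans (le_of_eq ?_)
  rw [succ_descFactorial_succ N k, Nat.add_sub_cancel]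
  ring

/-- Factor by factor, `(n - r - i) / (n - i) ≤ (n - r) / n`. -/
theorem pow_mul_descFactorial_sub_le (n r m : ℕ) :
    n ^ m * (n - r).descFactorial m ≤ (n - r) ^ m * n.descFactorial m := by
  induction m with
  | zero => simp
  | succ m ih =>
    have h : n * (n - r - m) ≤ (n - r) * (n - m) := by
      rcases le_or_gt (r + m) n with h | h
      · zify [show r ≤ n by lia, show m ≤ n by lia, show m ≤ n - r by lia]
        nlinarith [mul_nonneg (Int.natCast_nonneg r) (Int.natCast_nonneg m)]
      · rw [show n - r - m = 0 by lia]
        simp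
    rw [descFactorial_succ, descFactorial_succ, pow_succ, pow_succ]
    calc _ = (n * (n - r - m)) * (n ^ m * (n - r).descFactorial m) := by ring
      _ ≤ ((n - r) * (n - m)) * ((n - r) ^ m * n.descFactorial m) := Nat.mul_le_mul h ih
      _ = _ := by ring

/-- The counting bound for small `r`. -/
theorem descFactorial_bound_of_small (n d r k : ℕ) (hdr : d + 1 ≤ r)
    (hr : 2 * (r * (k + 2)) ≤ n) (hn : 4 * d * (k + 2) + 3 * d ^ 2 + 5 * (k + 2) ≤ n) :
    (n - r).descFactorial (k + 2) + (k + 2) * (r * r * (n - 2).descFactorial k) ≤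
      (n - d).descFactorial (k + 2) := by
  have hrn : 4 * r ≤ n := by nlinarith
  obtain ⟨j, rfl⟩ : ∃ j, r = d + j := ⟨r - d, by lia⟩
  -- With `j = r - d`, passing from `n - r` to `n - d` gains at least `j * (k + 2) * A`, so it
  -- remains to show `r ^ 2 * Q ≤ j * A`; this is `h2` combined with `h7`.
  have h1 := descFactorial_add_mul_le (n - (d + j)) j (k + 1)
  rw [show n - (d + j) + j = n - d by lia] at h1
  set Q := (n - 2).descFactorial k with hQ
  set A := (n - (d + j)).descFactorial (k + 1) with hA
  have h2 : n * Q ≤ 2 * A := by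
    have h := mul_descFactorial_le (n - 1) (d + j - 1) (k + 1) (by lia)
    rw [show n - 1 - (d + j - 1) = n - (d + j) by lia, ← hA] at h
    have h3 : (n - 1).descFactorial (k + 1) = (n - 1) * Q := by
      rw [show n - 1 = n - 2 + 1 by lia, succ_descFactorial_succ]
    rw [h3] at h
    have h4 : (n - 1) * Q ≤ A + (d + j - 1) * (k + 1) * Q := by
      refine Nat.le_of_mul_le_mul_left (h.trans (le_of_eq ?_)) (show 0 < n - 1 by lia)
      ring
    have h5 : 2 * ((d + j - 1) * (k + 1)) + 2 ≤ n := by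
      obtain ⟨i, hi⟩ : ∃ i, d + j = i + 1 := ⟨d + j - 1, by lia⟩
      rw [hi] at hr ⊢
      rw [Nat.add_sub_cancel]
      nlinarith
    have h6 : n * Q + (2 * ((d + j - 1) * (k + 1))) * Q ≤ 2 * ((n - 1) * Q) := by
      have h7 : n + 2 * ((d + j - 1) * (k + 1)) ≤ 2 * (n - 1) := by lia
      have := Nat.mul_le_mul_right Q h7
      linarith
    nlinarith
  -- If `d ≤ j`, then `r ≤ 2 * j` and `4 * r ≤ n` suffice. If `j < d`, the worst case is `r` just
  -- above `d`, and the term `3 * d ^ 2` in the bound on `n` is needed.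
  have h7 : 2 * ((d + j) * (d + j)) ≤ j * n := by
    rcases le_or_gt d j with h | h
    · nlinarith
    · have : 8 * d + 3 * d ^ 2 + 10 ≤ n := by nlinarith
      have hj : 1 ≤ j := by lia
      calc 2 * ((d + j) * (d + j)) = 2 * (d * d) + j * (4 * d + 2 * j) := by ring
        _ ≤ j * (2 * (d * d)) + j * (4 * d + 2 * d) := by
          refine Nat.add_le_add (Nat.le_mul_of_pos_left _ hj) (Nat.mul_le_mul_left _ (by lia))
        _ = j * (2 * (d * d) + (4 * d + 2 * d)) := by ring
        _ ≤ j * n := Nat.mul_le_mul_left _ (by nlinarith)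
  have h8 : (d + j) * (d + j) * Q ≤ j * A := by
    have a1 := Nat.mul_le_mul_right Q h7
    have a2 := Nat.mul_le_mul_left j h2
    nlinarith
  have h9 := Nat.mul_le_mul_left (k + 2) h8
  calc _ ≤ _ := Nat.add_le_add_left h9 _
    _ = _ := by ring
    _ ≤ _ := h1

/-- The counting bound for a single edge, when `r` is large. -/
theorem descFactorial_bound_of_large (n r k : ℕ) (h6 : n ≤ 6 * r) (h2 : 2 * r < n) :
    4 * ((n - r).descFactorial 2 * (n - 2).descFactorial k +
      2 * (r * r * (n - 2).descFactorial k)) ≤ 3 * n.descFactorial (k + 2) := by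
  have hn : n.descFactorial (k + 2) = n * (n - 1) * (n - 2).descFactorial k := by
    obtain ⟨m, rfl⟩ : ∃ m, n = m + 2 := ⟨n - 2, by lia⟩
    rw [succ_descFactorial_succ, succ_descFactorial_succ, ← mul_assoc]
    rfl
  -- The left side is convex in `r`, so only the ends `n / 6` and `(n - 1) / 2` matter: adding the
  -- product `(6r - n)(n - 2r - 1) ≥ 0` to it gives exactly `3n(n - 1) - 2r`.
  have h : 4 * ((n - r) * (n - r - 1) + 2 * (r * r)) ≤ 3 * (n * (n - 1)) := by
    zify [show r ≤ n by lia, show 1 ≤ n by lia, show 1 ≤ n - r by lia]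
    nlinarith [mul_nonneg (show (0 : ℤ) ≤ 6 * r - n by lia) (show (0 : ℤ) ≤ n - 2 * r - 1 by lia)]
  rw [hn]
  have e : (n - r).descFactorial 2 = (n - r) * (n - r - 1) := by
    simp [descFactorial_succ, mul_comm]
  rw [e]
  calc _ = 4 * ((n - r) * (n - r - 1) + 2 * (r * r)) * (n - 2).descFactorial k := by ring
    _ ≤ 3 * (n * (n - 1)) * (n - 2).descFactorial k := Nat.mul_le_mul_right _ h
    _ = _ := by ring

/-- The counting bound for about `n / (2 * r)` vertices, when `r` is of intermediate size. -/
theorem descFactorial_bound_of_medium (n r m t : ℕ) (h10 : 10 ≤ n) (h6 : 6 * r ≤ n)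
    (hm2 : 2 ≤ m) (hmt : m ≤ t) (hlow : n ≤ 2 * (r * m))
    (hupp : 2 * (r * m) ≤ n + 2 * r) :
    4 * ((n - r).descFactorial m * (n - m).descFactorial (t - m) +
      m * (r * r * (n - 2).descFactorial (t - 2))) ≤ 3 * n.descFactorial t := by
  have hnR : (10 : ℝ) ≤ n := by exact_mod_cast h10
  have e1 : (n.descFactorial t : ℝ) = n.descFactorial m * (n - m).descFactorial (t - m) := by
    rw [← descFactorial_mul_descFactorial hmt]; push_cast; ring
  have e2 : (n.descFactorial t : ℝ) = n * (n - 1) * (n - 2).descFactorial (t - 2) := by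
    rw [← descFactorial_mul_descFactorial (hm2.trans hmt)]
    push_cast [cast_descFactorial_two]
    ring
  -- The first term is at most `exp (-1/2) ≤ 0.61` of the total, the second at most `0.13`
  -- (asymptotically `1/9`); the sum stays below `3/4`.
  have hexp : Real.exp (-(1 / 2)) ≤ 0.61 := by
    have h1 := Real.exp_one_gt_d9
    have h2 : Real.exp (1 / 2) ^ 2 = Real.exp 1 := by
      rw [← Real.exp_nat_mul]; norm_num
    have h3 : (1.64 : ℝ) ≤ Real.exp (1 / 2) := by
      by_contra! hc
      nlinarith [Real.exp_pos (1 / 2)]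
    rw [Real.exp_neg]
    rw [inv_le_comm₀ (Real.exp_pos _) (by norm_num)]
    refine le_trans ?_ h3
    norm_num
  have hpow : (((n - r : ℕ) : ℝ) / n) ^ m ≤ 0.61 := by
    refine le_trans ?_ hexp
    have h1 : ((n - r : ℕ) : ℝ) / n ≤ Real.exp (-(r / n)) := by
      refine le_trans (le_of_eq ?_) (Real.one_sub_le_exp_neg _)
      rw [Nat.cast_sub (by lia)]
      field_simp
    refine (pow_le_pow_left₀ (by positivity) h1 m).trans ?_
    rw [← Real.exp_nat_mul, Real.exp_le_exp]
    have : (n : ℝ) ≤ 2 * (r * m) := by exact_mod_cast hlow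
    have h2 : (1 : ℝ) / 2 ≤ m * (r / n) := by
      rw [mul_div_assoc', div_le_div_iff₀ (by norm_num) (by linarith)]
      linarith
    linarith
  have hA : ((n - r).descFactorial m : ℝ) ≤ 0.61 * n.descFactorial m := by
    have h : (n : ℝ) ^ m * (n - r).descFactorial m ≤ ((n - r : ℕ) : ℝ) ^ m * n.descFactorial m := by
      exact_mod_cast pow_mul_descFactorial_sub_le n r m
    rw [div_pow, div_le_iff₀ (by positivity)] at hpow
    have h2 := h.trans (mul_le_mul_of_nonneg_right hpow (cast_nonneg _))
    have h3 : (0 : ℝ) < n ^ m := by positivity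
    refine le_of_mul_le_mul_left (h2.trans (le_of_eq ?_)) h3
    ring
  have hB : (m * (r * r) : ℝ) ≤ 0.13 * (n * (n - 1)) := by
    have a1 : (2 * (r * m) : ℝ) ≤ n + 2 * r := by exact_mod_cast hupp
    have a2 : (6 * r : ℝ) ≤ n := by exact_mod_cast h6
    have a3 : (0 : ℝ) ≤ r := by positivity
    have a4 := mul_le_mul_of_nonneg_right a1 a3
    nlinarith
  have hA' := mul_le_mul_of_nonneg_right hA
    (cast_nonneg (α := ℝ) ((n - m).descFactorial (t - m)))
  have hB' := mul_le_mul_of_nonneg_right hB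
    (cast_nonneg (α := ℝ) ((n - 2).descFactorial (t - 2)))
  have e3 : (0 : ℝ) ≤ n.descFactorial t := cast_nonneg _
  rw [mul_assoc, ← e1] at hA'
  rw [mul_assoc 0.13, ← e2] at hB'
  have : (4 * ((n - r).descFactorial m * (n - m).descFactorial (t - m) +
      m * (r * r * (n - 2).descFactorial (t - 2))) : ℝ) ≤ 3 * n.descFactorial t := by
    nlinarith
  exact_mod_cast this

/-- From `d * τ / n ≤ 1/4`: the clique copies in the extremal graph make up at least `3/4` of all
injections, the target for the large and medium bounds. -/
theorem three_mul_descFactorial_le (n d τ t : ℕ) (hτ : τ ≤ t) (hdn : d ≤ n) (hn : 4 * (d * τ) ≤ n)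
    (h0 : 0 < n) :
    3 * n.descFactorial t ≤ 4 * ((n - d).descFactorial τ * (n - τ).descFactorial (t - τ)) := by
  have h : 3 * n.descFactorial τ ≤ 4 * (n - d).descFactorial τ := by
    have h1 := mul_descFactorial_le n d τ hdn
    have h2 := Nat.mul_le_mul_right (n.descFactorial τ) hn
    refine Nat.le_of_mul_le_mul_left ?_ h0
    nlinarith
  rw [← descFactorial_mul_descFactorial hτ]
  calc _ = 3 * n.descFactorial τ * (n - τ).descFactorial (t - τ) := by ring
    _ ≤ 4 * (n - d).descFactorial τ * (n - τ).descFactorial (t - τ) := Nat.mul_le_mul_right _ h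
    _ = _ := by ring

theorem descFactorial_le_two_mul_sub (N s j : ℕ) (hs : 2 * (s * j) ≤ N) (hsN : s ≤ N) :
    N.descFactorial j ≤ 2 * (N - s).descFactorial j := by
  rcases Nat.eq_zero_or_pos N with rfl | h0
  · rw [Nat.zero_sub]; lia
  have h1 := mul_descFactorial_le N s j hsN
  have h2 := Nat.mul_le_mul_right (N.descFactorial j) hs
  refine Nat.le_of_mul_le_mul_left ?_ h0
  nlinarith

end Nat

/-! ### Compensating for edges inside the low-degree set -/

namespace SimpleGraph

open Finset

/-- The complete graph on the complement of `D`, with every vertex of `S` joined to every vertex of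
the independent set `D`. -/
def cliqueWithTwins {V : Type*} (D S : Finset V) : SimpleGraph V where
  Adj u v := u ≠ v ∧ ((u ∉ D ∧ v ∉ D) ∨ (u ∈ S ∧ v ∈ D) ∨ (v ∈ S ∧ u ∈ D))
  symm := ⟨fun u v h => ⟨h.1.symm, by tauto⟩⟩
  loopless := ⟨fun _ h => h.1 rfl⟩

set_option linter.unusedSectionVars false
variable {W V : Type*} [Fintype W] [DecidableEq W] [Fintype V] [DecidableEq V]

/-- An injection of `N` into `S` that fixes their common subset `B`. -/
theorem exists_injOn_fixing {N B S D : Finset V} (hBN : B ⊆ N) (hBS : B ⊆ S) (hcard : #N ≤ #S) (hSD : Disjoint S D) :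
    ∃ σ : V → V, Set.InjOn σ N ∧ (∀ v ∈ N, σ v ∈ S) ∧ ∀ v ∈ N, v ∈ D → σ v ∉ B := by
  classical
  have h1 : #(N \ B) ≤ #(S \ B) := by
    rw [card_sdiff_of_subset hBN, card_sdiff_of_subset hBS]
    lia
  obtain ⟨f⟩ : Nonempty ((N \ B : Finset V) ↪ (S \ B : Finset V)) :=
    Function.Embedding.nonempty_of_card_le (by rwa [Fintype.card_coe, Fintype.card_coe])
  let σ : V → V := fun v => if h : v ∈ N \ B then f ⟨v, h⟩ else v
  have hσ1 : ∀ v (h : v ∈ N \ B), σ v = f ⟨v, h⟩ := fun v h => dif_pos h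
  have hσ2 : ∀ v ∈ B, σ v = v := fun v h => dif_neg fun h' => (mem_sdiff.1 h').2 h
  have hσ3 : ∀ v ∈ N \ B, σ v ∈ S \ B := fun v h => hσ1 v h ▸ (f ⟨v, h⟩).2
  refine ⟨σ, ?_, ?_, ?_⟩
  · intro u hu v hv huv
    by_cases h : u ∈ B <;> by_cases h' : v ∈ B
    · rwa [hσ2 u h, hσ2 v h'] at huv
    · have := hσ3 v (mem_sdiff.2 ⟨hv, h'⟩)
      rw [← huv, hσ2 u h] at this
      exact absurd h (mem_sdiff.1 this).2
    · have := hσ3 u (mem_sdiff.2 ⟨hu, h⟩)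
      rw [huv, hσ2 v h'] at this
      exact absurd h' (mem_sdiff.1 this).2
    · rw [hσ1 u (mem_sdiff.2 ⟨hu, h⟩), hσ1 v (mem_sdiff.2 ⟨hv, h'⟩)] at huv
      exact congrArg Subtype.val (f.injective (Subtype.ext huv))
  · intro v hv
    by_cases h : v ∈ B
    · rw [hσ2 v h]
      exact hBS h
    · exact (mem_sdiff.1 (hσ3 v (mem_sdiff.2 ⟨hv, h⟩))).1
  · intro v hv hvD
    have h : v ∉ B := fun h => Finset.disjoint_left.1 hSD (hBS h) hvD
    exact (mem_sdiff.1 (hσ3 v (mem_sdiff.2 ⟨hv, h⟩))).2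

/-- If the vertices outside `D` form a clique and all the vertices of `D` have the same neighbours
`B` outside `D`, then copies of `F` using an edge inside `D` are compensated by copies in
`cliqueWithTwins D S`. -/
theorem card_copyEmbeddings_le_cliqueWithTwins (F : SimpleGraph W) (G : SimpleGraph V)
    [DecidableRel G.Adj] (D S B : Finset V) (hBS : B ⊆ S) (hSD : Disjoint S D)
    (hN : ∀ u ∈ D, G.neighborFinset u ⊆ B ∪ D) (hB : ∀ u ∈ D, B ⊆ G.neighborFinset u)
    (hdeg : ∀ u ∈ D, G.degree u ≤ #S)
    (hn : 2 * (#D * Fintype.card W) + Fintype.card W + #D ≤ Fintype.card V) :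
    #(copyEmbeddings F G) ≤ #(copyEmbeddings F (cliqueWithTwins D S)) := by
  classical
  set H := cliqueWithTwins D S
  -- `P`: copies with an edge inside `D`
  let P : Finset (W ↪ V) := {φ ∈ copyEmbeddings F G | ∃ x y, F.Adj x y ∧ φ x ∈ D ∧ φ y ∈ D}
  let Px (x : W) : Finset (W ↪ V) :=
    {φ ∈ copyEmbeddings F G | φ x ∈ D ∧ ∃ y, F.Adj x y ∧ φ y ∈ D}
  let Qx (x : W) : Finset (W ↪ V) :=
    {φ ∈ copyEmbeddings F H | (∀ w, φ w ∈ D ↔ w = x) ∧ ∃ y, F.Adj x y ∧ φ y ∉ B}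
  -- The factor 2 is affordable because a copy in `P` lies in `Px x` for both ends `x` of an edge
  -- sent into `D`.
  have hPQ : ∀ x, #(Px x) ≤ 2 * #(Qx x) := by
    intro x
    let Nx : Finset W := {y | F.Adj x y}
    have hxN : x ∉ Nx := by simp [Nx]
    let K : Finset W := insert x Nx
    have hK : #K = #Nx + 1 := card_insert_of_notMem hxN
    have hxK : x ∈ K := mem_insert_self _ _
    have hKc : #K ≤ Fintype.card W := card_le_univ _
    let AG : Finset (K ↪ V) := {α | α ⟨x, hxK⟩ ∈ D ∧
      (∀ y : K, F.Adj x y → G.Adj (α ⟨x, hxK⟩) (α y)) ∧ ∃ y : K, F.Adj x y ∧ α y ∈ D}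
    let AH : Finset (K ↪ V) := {α | α ⟨x, hxK⟩ ∈ D ∧
      (∀ y : K, F.Adj x y → α y ∈ S) ∧ ∃ y : K, F.Adj x y ∧ α y ∉ B}
    have hadjK : ∀ y : K, y.1 ≠ x → F.Adj x y := by
      intro y hy
      have h := (mem_insert.1 y.2).resolve_left hy
      exact (mem_filter.1 h).2
    -- Keep the image `u` of `x` and move the images of its neighbours by an injection of `N(u)`
    -- into `S` that fixes `B`. Vertices of `D` then land in `S \ B`, and `u` lets the map be
    -- undone.
    have hA : #AG ≤ #AH := by
      have hσ : ∀ u ∈ D, ∃ σ : V → V, Set.InjOn σ (G.neighborFinset u) ∧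
          (∀ v ∈ G.neighborFinset u, σ v ∈ S) ∧ ∀ v ∈ G.neighborFinset u, v ∈ D → σ v ∉ B :=
        fun u hu => exists_injOn_fixing (hB u hu) hBS (by simpa using hdeg u hu) hSD
      choose! σ hσi hσS hσB using hσ
      let tr (α : K ↪ V) (y : K) : V :=
        if y.1 = x then α ⟨x, hxK⟩ else σ (α ⟨x, hxK⟩) (α y)
      have tr_x (α) : tr α ⟨x, hxK⟩ = α ⟨x, hxK⟩ := if_pos rfl
      have tr_y (α) {y : K} (hy : y.1 ≠ x) : tr α y = σ (α ⟨x, hxK⟩) (α y) := if_neg hy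
      have trS : ∀ α ∈ AG, ∀ y : K, y.1 ≠ x → tr α y ∈ S := by
        intro α hα y hy
        simp only [AG, mem_filter, mem_univ, true_and] at hα
        rw [tr_y α hy]
        exact hσS _ hα.1 _ (by simpa using hα.2.1 y (hadjK y hy))
      have tr_inj : ∀ α ∈ AG, Function.Injective (tr α) := by
        intro α hα a b hab
        have hα' := hα
        simp only [AG, mem_filter, mem_univ, true_and] at hα'
        have hne : ∀ c : K, c.1 ≠ x → tr α c ≠ α ⟨x, hxK⟩ := fun c hc h =>
          Finset.disjoint_left.1 hSD (trS α hα c hc) (h ▸ hα'.1)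
        by_cases ha : a.1 = x <;> by_cases hb : b.1 = x
        · exact Subtype.ext (ha.trans hb.symm)
        · have : a = ⟨x, hxK⟩ := Subtype.ext ha
          subst this
          exact absurd (hab.symm.trans (tr_x α)) (hne b hb)
        · have : b = ⟨x, hxK⟩ := Subtype.ext hb
          subst this
          exact absurd (hab.trans (tr_x α)) (hne a ha)
        · rw [tr_y α ha, tr_y α hb] at hab
          refine α.injective (hσi _ hα'.1 ?_ ?_ hab)
          · simpa using hα'.2.1 a (hadjK a ha)
          · simpa using hα'.2.1 b (hadjK b hb)
      refine card_le_card_of_injOn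
        (fun α => if h : Function.Injective (tr α) then ⟨tr α, h⟩ else α) ?_ ?_
      · intro α hα
        have hi := tr_inj α hα
        have hα' := hα
        simp only [AG, coe_filter, mem_univ, true_and, Set.mem_ofPred_eq] at hα'
        simp only [dif_pos hi, AH, coe_filter, mem_univ, true_and, Set.mem_ofPred_eq]
        refine ⟨?_, ?_, ?_⟩
        · change tr α ⟨x, hxK⟩ ∈ D
          rw [tr_x]
          exact hα'.1
        · exact fun y hy => trS α hα y hy.ne'
        · obtain ⟨y, hy, hyD⟩ := hα'.2.2
          refine ⟨y, hy, ?_⟩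
          have := hσB _ hα'.1 (α y) (by simpa using hα'.2.1 y hy) hyD
          change tr α y ∉ B
          rwa [tr_y α hy.ne']
      · intro α hα β hβ hab
        have hi := tr_inj α hα
        have hj := tr_inj β hβ
        have hα' := hα
        have hβ' := hβ
        simp only [AG, coe_filter, mem_univ, true_and, Set.mem_ofPred_eq] at hα' hβ'
        simp only [dif_pos hi, dif_pos hj] at hab
        have hfun : ∀ y, tr α y = tr β y := fun y => DFunLike.congr_fun hab y
        have hx : α ⟨x, hxK⟩ = β ⟨x, hxK⟩ := by
          rw [← tr_x α, ← tr_x β]; exact hfun _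
        ext y
        by_cases hy : y.1 = x
        · have : y = ⟨x, hxK⟩ := Subtype.ext hy
          rw [this, hx]
        · have h := hfun y
          rw [tr_y α hy, tr_y β hy, ← hx] at h
          refine hσi _ hα'.1 ?_ ?_ h
          · simpa using hα'.2.1 y (hadjK y hy)
          · rw [hx]
            simpa using hβ'.2.1 y (hadjK y hy)
    have hP : #(Px x) ≤ #AG * (Fintype.card V - #K).descFactorial (Fintype.card W - #K) := by
      have h := card_embedding_extend_family K AG (fun α => univ.image α) (by simp)
      rw [sum_congr rfl (g := fun _ =>
        (Fintype.card V - #K).descFactorial (Fintype.card W - #K)), sum_const, smul_eq_mul] at h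
      · rw [← h]
        refine card_le_card fun φ hφ => ?_
        simp only [Px, mem_filter, mem_copyEmbeddings] at hφ
        simp only [AG, mem_filter, mem_univ, true_and, mem_image, not_exists]
        refine ⟨⟨hφ.2.1, fun y hy => hφ.1 _ _ hy, ?_⟩, ?_⟩
        · obtain ⟨y, hy, hyD⟩ := hφ.2.2
          exact ⟨⟨y, by simp [K, Nx, hy]⟩, hy, hyD⟩
        · intro w hw k hk
          exact hw (φ.injective hk ▸ k.2)
      · intro α _
        rw [card_image_of_injective _ α.injective, card_univ, Fintype.card_coe]
    -- The vertices outside `K` are sent off `D` as well. Since `α` meets `D` only at `x`, exactly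
    -- `#D + #Nx` values are forbidden.
    have hQ : #AH * (Fintype.card V - (#D + #Nx)).descFactorial (Fintype.card W - #K) ≤
        #(Qx x) := by
      have h := card_embedding_extend_family K AH (fun α => D ∪ univ.image α) (by simp)
      rw [sum_congr rfl (g := fun _ =>
        (Fintype.card V - (#D + #Nx)).descFactorial (Fintype.card W - #K)), sum_const,
        smul_eq_mul] at h
      · rw [← h]
        refine card_le_card fun φ hφ => ?_
        simp only [AH, mem_filter, mem_univ, true_and, mem_image, not_exists, mem_union,
          not_or] at hφ
        obtain ⟨⟨hxD, hS, hyB⟩, hout⟩ := hφ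
        replace hxD : φ x ∈ D := hxD
        replace hS : ∀ y, F.Adj x y → φ y ∈ S := fun y hy => hS ⟨y, by simp [K, Nx, hy]⟩ hy
        have hD : ∀ w, w ≠ x → φ w ∉ D := by
          intro w hw
          by_cases hwK : w ∈ K
          · exact Finset.disjoint_left.1 hSD (hS w (hadjK ⟨w, hwK⟩ hw))
          · exact (hout w hwK).1
        simp only [Qx, mem_filter, mem_copyEmbeddings]
        refine ⟨fun a b hab => ⟨φ.injective.ne hab.ne, ?_⟩, fun w => ⟨fun h => ?_, ?_⟩, ?_⟩
        · by_cases ha : a = x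
          · subst ha
            exact Or.inr (Or.inr ⟨hS b hab, hxD⟩)
          · by_cases hb : b = x
            · subst hb
              exact Or.inr (Or.inl ⟨hS a hab.symm, hxD⟩)
            · exact Or.inl ⟨hD a ha, hD b hb⟩
        · by_contra hw
          exact hD w hw h
        · rintro rfl
          exact hxD
        · obtain ⟨y, hy, hyB⟩ := hyB
          exact ⟨y, hy, hyB⟩
      · intro α hα
        simp only [AH, mem_filter, mem_univ, true_and] at hα
        have hun : D ∪ univ.image α = D ∪ (univ.erase ⟨x, hxK⟩).image α := by
          ext v
          simp only [mem_union, mem_image, mem_univ, true_and, mem_erase, and_true]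
          constructor
          · rintro (h | ⟨y, rfl⟩)
            · exact Or.inl h
            · by_cases hy : y = ⟨x, hxK⟩
              · exact Or.inl (hy ▸ hα.1)
              · exact Or.inr ⟨y, hy, rfl⟩
          · rintro (h | ⟨y, -, rfl⟩)
            · exact Or.inl h
            · exact Or.inr ⟨y, rfl⟩
        rw [hun, Finset.card_union_of_disjoint, card_image_of_injective _ α.injective,
          card_erase_of_mem (mem_univ _), card_univ, Fintype.card_coe, hK, Nat.add_sub_cancel]
        refine Finset.disjoint_left.2 ?_
        intro v hv hv'
        obtain ⟨y, hy, rfl⟩ := mem_image.1 hv'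
        refine Finset.disjoint_left.1 hSD (hα.2.1 y (hadjK y fun h => ?_)) hv
        exact (mem_erase.1 hy).1 (Subtype.ext h)
    rcases Finset.eq_empty_or_nonempty D with hD | hD
    · have : Px x = ∅ := by simp [Px, hD]
      simp [this]
    have hDpos := hD.card_pos
    -- Avoiding the other `#D - 1` vertices of `D` at most halves the number of extensions, as `n`
    -- is large.
    have hdesc : (Fintype.card V - #K).descFactorial (Fintype.card W - #K) ≤
        2 * (Fintype.card V - (#D + #Nx)).descFactorial (Fintype.card W - #K) := by
      have h := Nat.descFactorial_le_two_mul_sub (Fintype.card V - #K) (#D - 1)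
        (Fintype.card W - #K) ?_ (by lia)
      · rwa [show Fintype.card V - #K - (#D - 1) = Fintype.card V - (#D + #Nx) by lia] at h
      · have := Nat.mul_le_mul (show #D - 1 ≤ #D by lia)
          (show Fintype.card W - #K ≤ Fintype.card W by lia)
        lia
    calc _ ≤ _ := hP
      _ ≤ #AH * (2 * (Fintype.card V - (#D + #Nx)).descFactorial (Fintype.card W - #K)) :=
        Nat.mul_le_mul hA hdesc
      _ = 2 * (#AH * (Fintype.card V - (#D + #Nx)).descFactorial (Fintype.card W - #K)) := by ring
      _ ≤ _ := Nat.mul_le_mul_left _ hQ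
  have hPle : #P ≤ ∑ x, #(Qx x) := by
    have h2 : #P * 2 ≤ ∑ x, #(Px x) := by
      have e : ∑ x, #(Px x) = ∑ x, #{φ ∈ P | φ x ∈ D ∧ ∃ y, F.Adj x y ∧ φ y ∈ D} := by
        refine sum_congr rfl fun x _ => congrArg card ?_
        ext φ
        simp only [Px, P, mem_filter]
        constructor
        · rintro ⟨h, hx, y, hy⟩
          exact ⟨⟨h, x, y, hy.1, hx, hy.2⟩, hx, y, hy⟩
        · rintro ⟨⟨h, -⟩, h'⟩
          exact ⟨h, h'⟩
      have e' := e.trans (sum_card_bipartiteAbove_eq_sum_card_bipartiteBelow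
        (s := univ) (t := P) fun (x : W) (φ : W ↪ V) => φ x ∈ D ∧ ∃ y, F.Adj x y ∧ φ y ∈ D)
      rw [e', ← smul_eq_mul]
      refine card_nsmul_le_sum _ _ _ fun φ hφ => ?_
      simp only [P, mem_filter] at hφ
      obtain ⟨-, x, y, hxy, hx, hy⟩ := hφ
      refine one_lt_card.2 ⟨x, ?_, y, ?_, hxy.ne⟩
      · simp only [bipartiteBelow, mem_filter, mem_univ, true_and]
        exact ⟨hx, y, hxy, hy⟩
      · simp only [bipartiteBelow, mem_filter, mem_univ, true_and]
        exact ⟨hy, x, hxy.symm, hx⟩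
    have h3 : ∑ x, #(Px x) ≤ 2 * ∑ x, #(Qx x) := by
      rw [mul_sum]
      exact sum_le_sum fun x _ => hPQ x
    lia
  have hdisj : ∑ x, #(Qx x) = #(univ.biUnion Qx) := by
    refine (card_biUnion fun x _ y _ hxy => ?_).symm
    refine Finset.disjoint_left.2 ?_
    intro φ h1 h2
    simp only [Qx, mem_filter] at h1 h2
    exact hxy ((h2.2.1 x).1 ((h1.2.1 x).2 rfl))
  have hsplit : #(copyEmbeddings F G) = #P + #(copyEmbeddings F G \ P) := by
    rw [add_comm, card_sdiff_add_card_eq_card (filter_subset _ _)]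
  -- A copy in `G` without an edge inside `D` uses only edges from `D` to `B ⊆ S`, so it is a copy
  -- in `H`; for the same reason it lies in no `Qx x`.
  have hmain : #(univ.biUnion Qx) + #(copyEmbeddings F G \ P) ≤ #(copyEmbeddings F H) := by
    rw [← Finset.card_union_of_disjoint]
    · refine card_le_card (union_subset (biUnion_subset.2 fun x _ => filter_subset _ _) ?_)
      intro φ hφ
      simp only [P, mem_sdiff, mem_filter, not_and, not_exists] at hφ
      obtain ⟨hφG, hφP⟩ := hφ
      have hno := hφP hφG
      rw [mem_copyEmbeddings] at hφG ⊢
      intro a b hab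
      have hedge : ∀ a b, F.Adj a b → φ a ∈ D → φ b ∈ S := by
        intro a b hab ha
        have h1 := hN _ ha ((mem_neighborFinset _ _ _).2 (hφG a b hab))
        exact hBS ((mem_union.1 h1).resolve_right (hno a b hab ha))
      refine ⟨φ.injective.ne hab.ne, ?_⟩
      by_cases ha : φ a ∈ D
      · exact Or.inr (Or.inr ⟨hedge a b hab ha, ha⟩)
      · by_cases hb : φ b ∈ D
        · exact Or.inr (Or.inl ⟨hedge b a hab.symm hb, hb⟩)
        · exact Or.inl ⟨ha, hb⟩
    · refine Finset.disjoint_left.2 ?_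
      intro φ h1 h2
      simp only [Qx, mem_biUnion, mem_univ, true_and, mem_filter] at h1
      simp only [P, mem_sdiff, mem_filter, not_and, not_exists] at h2
      obtain ⟨x, -, hx, y, hy, hyB⟩ := h1
      have hxD := (hx x).2 rfl
      have := hN _ hxD ((mem_neighborFinset _ _ _).2 (mem_copyEmbeddings.1 h2.1 x y hy))
      rcases mem_union.1 this with h | h
      · exact hyB h
      · exact h2.2 h2.1 x y hy hxD h
  lia

theorem card_filter_fin_lt {n d : ℕ} (hd : d ≤ n) : #{v : Fin n | (v : ℕ) < d} = d := by
  rw [Fin.card_filter_val_lt]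
  lia

theorem card_filter_fin_add_ge {n d : ℕ} (hd : d ≤ n) : #{v : Fin n | n ≤ (v : ℕ) + d} = d := by
  have h := card_filter_add_card_filter_not (s := (univ : Finset (Fin n))) (fun v => (v : ℕ) < n - d)
  rw [card_filter_fin_lt (by lia)] at h
  simp only [card_univ, Fintype.card_fin] at h
  have e : #{v : Fin n | n ≤ (v : ℕ) + d} = #{v : Fin n | ¬ (v : ℕ) < n - d} := by
    congr 1
    ext v
    simp only [mem_filter, mem_univ, true_and]
    lia
  lia

/-- Both graphs are determined by a partition into three classes (`D`, `S`, the rest) of equal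
sizes, so any class-preserving bijection works. -/
theorem nonempty_iso_extremalGraph {n d : ℕ} (hV : Fintype.card V = n) (hd : 2 * d ≤ n)
    (D S : Finset V) (hD : #D = d) (hS : #S = d) (hSD : Disjoint S D) :
    Nonempty (cliqueWithTwins D S ≃g extremalGraph n d) := by
  classical
  let c : V → Fin 3 := fun v => if v ∈ D then 0 else if v ∈ S then 1 else 2
  let c' : Fin n → Fin 3 := fun v => if n ≤ (v : ℕ) + d then 0 else if (v : ℕ) < d then 1 else 2
  have h0 : ∀ v, c v = 0 ↔ v ∈ D := by
    intro v; simp only [c]; split_ifs <;> simp_all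
  have h1 : ∀ v, c v = 1 ↔ v ∈ S := by
    intro v; simp only [c]; split_ifs with h h'
    · simpa using fun hh => Finset.disjoint_left.1 hSD hh h
    · simp_all
    · simp_all
  have h0' : ∀ v, c' v = 0 ↔ n ≤ (v : ℕ) + d := by
    intro v; simp only [c']; split_ifs <;> simp_all
  have h1' : ∀ v, c' v = 1 ↔ (v : ℕ) < d := by
    intro v; simp only [c']; split_ifs <;> simp <;> lia
  have e0 : #{v | c v = 0} = #{v | c' v = 0} := by
    simp only [h0, h0', card_filter_fin_add_ge (show d ≤ n by lia)]
    simpa using hD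
  have e1 : #{v | c v = 1} = #{v | c' v = 1} := by
    simp only [h1, h1', card_filter_fin_lt (show d ≤ n by lia)]
    simpa using hS
  have e2 : #{v | c v = 2} = #{v | c' v = 2} := by
    have a := card_eq_sum_card_fiberwise (s := (univ : Finset V)) (t := (univ : Finset (Fin 3)))
      (f := c) (by simp)
    have b := card_eq_sum_card_fiberwise (s := (univ : Finset (Fin n)))
      (t := (univ : Finset (Fin 3))) (f := c') (by simp)
    rw [Fin.sum_univ_three] at a b
    simp only [card_univ, hV, Fintype.card_fin] at a b
    lia
  have hcard : ∀ i, Fintype.card {v // c v = i} = Fintype.card {v // c' v = i} := by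
    intro i
    rw [Fintype.card_subtype, Fintype.card_subtype]
    fin_cases i
    · exact e0
    · exact e1
    · exact e2
  let e : V ≃ Fin n := (Equiv.sigmaFiberEquiv c).symm.trans
    ((Equiv.sigmaCongrRight fun i => Fintype.equivOfCardEq (hcard i)).trans
      (Equiv.sigmaFiberEquiv c'))
  have he : ∀ v, c' (e v) = c v := fun v =>
    (Fintype.equivOfCardEq (hcard (c v)) ⟨v, rfl⟩).2
  have heD : ∀ v, n ≤ (e v : ℕ) + d ↔ v ∈ D := fun v => by rw [← h0', he, h0]
  have heS : ∀ v, (e v : ℕ) < d ↔ v ∈ S := fun v => by rw [← h1', he, h1]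
  refine ⟨e, ?_⟩
  intro u v
  simp only [extremalGraph, cliqueWithTwins, ← not_le, heD, ne_eq, e.injective.eq_iff]
  simp only [not_le, heS]

end SimpleGraph

/-! ### Hamiltonian cycles and degree conditions -/

namespace SimpleGraph

open Finset

variable {V : Type*} [Fintype V] [DecidableEq V]

theorem isHamiltonian_of_cyclic_enumeration (G : SimpleGraph V) (n : ℕ) (hn : Fintype.card V = n)
    (h3 : 3 ≤ n) (a : ℕ → V) (ha : Set.InjOn a (Set.Iio n))
    (hadj : ∀ i, i + 1 < n → G.Adj (a i) (a (i + 1))) (hlast : G.Adj (a (n - 1)) (a 0)) :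
    G.IsHamiltonian := by
  intro _
  obtain ⟨p, hp⟩ : ∃ p : G.Walk (a 0) (a (n - 1)), p.support = List.map a (List.range n) := by
    have key : ∀ m, m + 1 ≤ n → ∃ p : G.Walk (a 0) (a m), p.support = List.map a (List.range (m + 1)) := by
      intro m
      induction m with
      | zero => intro _; exact ⟨.nil, by simp⟩
      | succ m ih =>
        intro hm
        obtain ⟨p, hp⟩ := ih (by lia)
        refine ⟨p.concat (hadj m (by lia)), ?_⟩
        rw [Walk.support_concat, hp, List.range_succ (n := m + 1)]
        simp
    obtain ⟨p, hp⟩ := key (n - 1) (by lia)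
    exact ⟨p, by rw [hp]; congr 2; lia⟩
  have hpath : p.IsPath := by
    rw [Walk.isPath_def, hp]
    refine List.Nodup.map_on ?_ List.nodup_range
    intro x hx y hy hxy
    exact ha (by simpa using hx) (by simpa using hy) hxy
  have hlen : p.length + 1 = n := by
    rw [← Walk.length_support, hp]; simp
  refine ⟨_, Walk.cons hlast p, Walk.isHamiltonianCycle_iff_isCycle_and_length_eq.2 ⟨?_, ?_⟩⟩
  · rw [Walk.cons_isCycle_iff]
    refine ⟨hpath, fun hmem => ?_⟩
    rw [Sym2.eq_swap] at hmem
    have := hpath.length_eq_one_of_mem_edges hmem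
    lia
  · rw [Walk.length_cons, hlen, hn]

theorem IsHamiltonian.exists_cyclic_enumeration {G : SimpleGraph V} (hG : G.IsHamiltonian) (n : ℕ)
    (hn : Fintype.card V = n) (h3 : 3 ≤ n) (u : V) :
    ∃ a : ℕ → V, Set.InjOn a (Set.Iio n) ∧ (∀ i, i < n → G.Adj (a i) (a (i + 1))) ∧
      a 0 = u ∧ a n = u := by
  have : Nontrivial V := Fintype.one_lt_card_iff_nontrivial.1 (by lia)
  obtain ⟨p, hp⟩ := hG.exists_isHamiltonianCycle u
  have hlen := hp.length_eq
  rw [hn] at hlen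
  refine ⟨p.getVert, ?_, ?_, p.getVert_zero, ?_⟩
  · refine hp.isCycle.getVert_injOn'.mono fun i hi => ?_
    simp only [Set.mem_Iio, Set.mem_ofPred_eq] at *
    lia
  · intro i hi
    exact p.adj_getVert_succ (by lia)
  · rw [← hlen, p.getVert_length]

theorem surj_of_injOn_Iio {n : ℕ} (hn : Fintype.card V = n) {a : ℕ → V}
    (ha : Set.InjOn a (Set.Iio n)) (v : V) : ∃ i < n, a i = v := by
  have h : (range n).image a = univ := by
    rw [← card_eq_iff_eq_univ, card_image_of_injOn (by simpa using ha), card_range, hn]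
  have := h ▸ mem_univ v
  simpa using this

/-- The crossing argument: a Hamiltonian path whose ends have degree sum at least `n` can be closed
up to a Hamiltonian cycle. -/
theorem isHamiltonian_of_path_of_degree_add_degree (G : SimpleGraph V) [DecidableRel G.Adj] (n : ℕ)
    (hn : Fintype.card V = n) (h3 : 3 ≤ n) (a : ℕ → V) (ha : Set.InjOn a (Set.Iio n))
    (hadj : ∀ i, i + 1 < n → G.Adj (a i) (a (i + 1)))
    (hdeg : n ≤ G.degree (a 0) + G.degree (a (n - 1))) : G.IsHamiltonian := by
  set I : Finset ℕ := {i ∈ range (n - 1) | G.Adj (a 0) (a (i + 1))} with hI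
  set J : Finset ℕ := {i ∈ range (n - 1) | G.Adj (a (n - 1)) (a i)} with hJ
  have hIc : G.degree (a 0) ≤ #I := by
    rw [← card_neighborFinset_eq_degree]
    refine (card_le_card (t := I.image fun i => a (i + 1)) fun v hv => ?_).trans card_image_le
    rw [mem_neighborFinset] at hv
    obtain ⟨i, hi, rfl⟩ := surj_of_injOn_Iio hn ha v
    obtain rfl | hi0 := Nat.eq_zero_or_pos i
    · exact absurd rfl hv.ne
    · refine mem_image.2 ⟨i - 1, ?_, by rw [Nat.sub_add_cancel hi0]⟩
      rw [hI, mem_filter, mem_range, Nat.sub_add_cancel hi0]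
      exact ⟨by lia, hv⟩
  have hJc : G.degree (a (n - 1)) ≤ #J := by
    rw [← card_neighborFinset_eq_degree]
    refine (card_le_card (t := J.image a) fun v hv => ?_).trans card_image_le
    rw [mem_neighborFinset] at hv
    obtain ⟨i, hi, rfl⟩ := surj_of_injOn_Iio hn ha v
    refine mem_image.2 ⟨i, ?_, rfl⟩
    rw [hJ, mem_filter, mem_range]
    refine ⟨?_, hv⟩
    by_contra hcon
    exact hv.ne (by congr 1; lia)
  have hU : #(I ∪ J) ≤ n - 1 := by
    have := card_le_card (union_subset (filter_subset _ _) (filter_subset _ _) : I ∪ J ⊆ range (n - 1))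
    simpa using this
  have hpos : 0 < #(I ∩ J) := by
    have := card_union_add_card_inter I J
    lia
  obtain ⟨i, hi⟩ := card_pos.1 hpos
  simp only [hI, hJ, mem_inter, mem_filter, mem_range] at hi
  obtain ⟨⟨hin, hi1⟩, -, hi2⟩ := hi
  -- The cycle is `a 0, …, a i, a (n - 1), a (n - 2), …, a (i + 1)`, closing back to `a 0`.
  refine isHamiltonian_of_cyclic_enumeration G n hn h3
    (fun j => if j ≤ i then a j else a (n + i - j)) ?_ ?_ ?_
  · intro x hx y hy hxy
    simp only [Set.mem_Iio] at hx hy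
    dsimp only at hxy
    split_ifs at hxy <;>
    · have := ha (Set.mem_Iio.2 (by lia)) (Set.mem_Iio.2 (by lia)) hxy
      lia
  · intro j hj
    rcases lt_trichotomy j i with h | rfl | h
    · simpa [h.le, Nat.succ_le_of_lt h] using hadj j hj
    · have : n + j - (j + 1) = n - 1 := by lia
      simpa [this] using hi2.symm
    · have h1 : ¬ j ≤ i := by lia
      have h2 : ¬ j + 1 ≤ i := by lia
      simp only [h1, h2, if_false]
      have h3 := hadj (n + i - (j + 1)) (by lia)
      rw [show n + i - (j + 1) + 1 = n + i - j by lia] at h3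
      exact h3.symm
  · have h1 : ¬ n - 1 ≤ i := by lia
    simp only [h1, if_false, Nat.zero_le, if_true]
    rw [show n + i - (n - 1) = i + 1 by lia]
    exact hi1.symm

/-- Ore's theorem for edge-maximal nonhamiltonian graphs. -/
theorem degree_add_degree_lt_of_maximal (G : SimpleGraph V) [DecidableRel G.Adj]
    (h3 : 3 ≤ Fintype.card V)
    (hG : Maximal (fun G : SimpleGraph V => ¬ G.IsHamiltonian) G) {u v : V} (huv : u ≠ v)
    (hadj : ¬ G.Adj u v) : G.degree u + G.degree v < Fintype.card V := by
  obtain ⟨n, hn⟩ : ∃ n, Fintype.card V = n := ⟨_, rfl⟩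
  rw [hn] at h3 ⊢
  by_contra! hdeg
  have hlt : G < G ⊔ edge u v := by
    refine lt_of_le_of_ne le_sup_left fun h => hadj ?_
    rw [h]
    simp [edge_adj, huv]
  have hham : (G ⊔ edge u v).IsHamiltonian := by
    by_contra hcon
    exact hG.not_prop_of_gt hlt hcon
  obtain ⟨a, ha, hadj', h0, hlast⟩ := hham.exists_cyclic_enumeration n hn h3 u
  have hsup : ∀ x y, (G ⊔ edge u v).Adj x y → G.Adj x y ∨ (x = u ∧ y = v) ∨ (x = v ∧ y = u) := by
    intro x y hxy
    rw [sup_adj, edge_adj] at hxy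
    tauto
  have hu : ∀ i, i < n → a i = u → i = 0 := fun i hi h =>
    ha (Set.mem_Iio.2 hi) (Set.mem_Iio.2 (by lia)) (h.trans h0.symm)
  obtain ⟨j, hj, hjv⟩ := surj_of_injOn_Iio hn ha v
  have hv : ∀ i, i < n → a i = v → i = j := fun i hi h =>
    ha (Set.mem_Iio.2 hi) (Set.mem_Iio.2 hj) (h.trans hjv.symm)
  have hj0 : j ≠ 0 := by rintro rfl; exact huv (h0.symm.trans hjv)
  apply hG.prop
  -- The cycle starts at `u`. If `v` is next to `u` on it (`j = 1` or `j = n - 1`), removing `uv`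
  -- leaves a Hamiltonian path of `G` between them; otherwise the cycle already lies in `G`.
  by_cases hj1 : j = 1
  · subst hj1
    refine isHamiltonian_of_path_of_degree_add_degree G n hn h3
      (fun i => if i + 1 = n then u else a (i + 1)) ?_ ?_ ?_
    · intro x hx y hy hxy
      simp only [Set.mem_Iio] at hx hy
      dsimp only at hxy
      split_ifs at hxy with h1 h2 h2
      · lia
      · have := hu _ (by lia) hxy.symm; lia
      · have := hu _ (by lia) hxy; lia
      · have := ha (Set.mem_Iio.2 (by lia)) (Set.mem_Iio.2 (by lia)) hxy
        lia
    · intro i hi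
      have h1 : ¬ i + 1 = n := by lia
      simp only [h1, if_false]
      have h2 : (if i + 1 + 1 = n then u else a (i + 1 + 1)) = a (i + 1 + 1) := by
        split_ifs with h
        · rw [h, hlast]
        · rfl
      rw [h2]
      rcases hsup _ _ (hadj' (i + 1) hi) with h | ⟨h, -⟩ | ⟨h, h'⟩
      · exact h
      · have := hu _ (by lia) h; lia
      · have hi0 := hv _ (by lia) h
        have hi0 : i = 0 := by lia
        subst hi0
        have := hu 2 (by lia) h'
        lia
    · have h1 : ¬ 0 + 1 = n := by lia
      have h2 : n - 1 + 1 = n := by lia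
      rw [if_neg h1, if_pos h2, zero_add, hjv]
      lia
  by_cases hjn : j = n - 1
  · subst hjn
    refine isHamiltonian_of_path_of_degree_add_degree G n hn h3 a ha ?_ ?_
    · intro i hi
      rcases hsup _ _ (hadj' i (by lia)) with h | ⟨h, h'⟩ | ⟨h, h'⟩
      · exact h
      · have := hu _ (by lia) h
        have := hv _ hi h'
        lia
      · have := hu _ hi h'
        lia
    · rw [h0, hjv]
      lia
  · have hall : ∀ i, i < n → G.Adj (a i) (a (i + 1)) := by
      intro i hi
      rcases hsup _ _ (hadj' i hi) with h | ⟨h, h'⟩ | ⟨h, h'⟩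
      · exact h
      · have := hu _ hi h
        have := hv _ (by lia) h'
        lia
      · have hij := hv _ hi h
        have := hu (i + 1) (by lia) h'
        lia
    refine isHamiltonian_of_cyclic_enumeration G n hn h3 a ha (fun i hi => hall i (by lia)) ?_
    have := hall (n - 1) (by lia)
    rwa [show n - 1 + 1 = n by lia, hlast, ← h0] at this

theorem isHamiltonian_of_complete (G : SimpleGraph V) (h3 : 3 ≤ Fintype.card V)
    (hG : ∀ u v, u ≠ v → G.Adj u v) : G.IsHamiltonian := by
  let e := Fintype.equivFin V
  have hpos : 0 < Fintype.card V := by lia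
  let a : ℕ → V := fun i => e.symm ⟨i % Fintype.card V, Nat.mod_lt _ hpos⟩
  have ha : Set.InjOn a (Set.Iio (Fintype.card V)) := by
    intro x hx y hy hxy
    have := congrArg Fin.val (e.symm.injective hxy)
    simpa [Nat.mod_eq_of_lt (Set.mem_Iio.1 hx), Nat.mod_eq_of_lt (Set.mem_Iio.1 hy)] using this
  refine isHamiltonian_of_cyclic_enumeration G _ rfl h3 a ha (fun i hi => hG _ _ fun h => ?_)
    (hG _ _ fun h => ?_)
  · have := ha (Set.mem_Iio.2 (by lia)) (Set.mem_Iio.2 hi) h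
    lia
  · have := ha (Set.mem_Iio.2 (by lia)) (Set.mem_Iio.2 hpos) h
    lia

/-- Two nonadjacent vertices outside a set `Z` of vertices of small degree yield Chvátal's degree
condition in a graph satisfying the negation of Ore's condition. -/
theorem exists_degree_le_card_filter (G : SimpleGraph V) [DecidableRel G.Adj]
    (hore : ∀ u v, u ≠ v → ¬ G.Adj u v → G.degree u + G.degree v < Fintype.card V)
    (Z : Finset V) (hZ : ∀ z ∈ Z, ∀ v ∉ Z, G.degree z ≤ G.degree v)
    (hex : ∃ u ∉ Z, ∃ v ∉ Z, u ≠ v ∧ ¬ G.Adj u v) :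
    ∃ u ∉ Z, 2 * G.degree u < Fintype.card V ∧
      G.degree u ≤ #{v | G.degree v ≤ G.degree u} := by
  classical
  let P : Finset (V × V) := {p | p.1 ∉ Z ∧ p.2 ∉ Z ∧ p.1 ≠ p.2 ∧ ¬ G.Adj p.1 p.2}
  have hP : ∀ u v, (u, v) ∈ P ↔ u ∉ Z ∧ v ∉ Z ∧ u ≠ v ∧ ¬ G.Adj u v := by simp [P]
  obtain ⟨u₀, hu₀, v₀, hv₀, h₀⟩ := hex
  -- For a pair of maximal degree sum with `deg u ≤ deg v`, every non-neighbour of `v` has degree at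
  -- most `deg u`, and there are `n - 1 - deg v ≥ deg u` of them.
  obtain ⟨⟨u, v⟩, huvP, hmax⟩ := P.exists_max_image (fun p => G.degree p.1 + G.degree p.2)
    ⟨(u₀, v₀), (hP _ _).2 ⟨hu₀, hv₀, h₀⟩⟩
  wlog huv : G.degree u ≤ G.degree v generalizing u v
  · refine this v u ?_ ?_ (by lia)
    · rw [hP] at huvP ⊢
      exact ⟨huvP.2.1, huvP.1, huvP.2.2.1.symm, fun h => huvP.2.2.2 h.symm⟩
    · intro p hp
      have := hmax p hp
      dsimp only at this ⊢
      lia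
  obtain ⟨hu, hv, hne, hadj⟩ := (hP _ _).1 huvP
  have hlt := hore u v hne hadj
  refine ⟨u, hu, by lia, ?_⟩
  have hsub : (insert v (G.neighborFinset v))ᶜ ⊆ ({w | G.degree w ≤ G.degree u} : Finset V) := by
    intro w hw
    simp only [mem_compl, mem_insert, mem_neighborFinset, not_or] at hw
    rw [mem_filter]
    refine ⟨mem_univ _, ?_⟩
    by_cases hwZ : w ∈ Z
    · exact hZ w hwZ u hu
    · have := hmax (w, v) ((hP _ _).2 ⟨hwZ, hv, hw.1, fun h => hw.2 h.symm⟩)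
      dsimp only at this
      lia
  have := card_le_card hsub
  rw [card_compl, card_insert_of_notMem (by simp), card_neighborFinset_eq_degree] at this
  lia

end SimpleGraph

/-! ### The two cases and the conclusion -/

namespace SimpleGraph

open Finset

variable {W V : Type*} [Fintype W] [DecidableEq W] [Fintype V] [DecidableEq V]

/-- Graphs with `r` vertices of degree at most `r`, where `d < r < n / 2`, contain no more copies
of `F` than a clique on `n - d` vertices with `d` isolated vertices. -/
theorem card_copyEmbeddings_le_of_card_degree_le (F : SimpleGraph W) (G : SimpleGraph V)
    [DecidableRel G.Adj] {n d t r : ℕ} (hV : Fintype.card V = n) (ht : Fintype.card W = t)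
    (hd : 1 ≤ d) (hn : 4 * d * t + 3 * d ^ 2 + 5 * t ≤ n) (hdr : d + 1 ≤ r) (hrn : 2 * r < n)
    (hr : r ≤ #{v | G.degree v ≤ r}) {T : Finset W} (hT : ∀ x, x ∈ T ↔ ∃ y, F.Adj x y) :
    #(copyEmbeddings F G) ≤
      (n - d).descFactorial #T * (n - #T).descFactorial (t - #T) := by
  obtain ⟨D, hDsub, hD⟩ := exists_subset_card_eq hr
  have hdeg : ∀ v ∈ D, G.degree v ≤ r := fun v hv => (mem_filter.1 (hDsub hv)).2
  have hTt : #T ≤ t := ht ▸ card_le_univ T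
  have hU : ∀ X ⊆ T, #(copyEmbeddings F G) ≤ (n - r).descFactorial #X *
      (n - #X).descFactorial (t - #X) + #X * (r * r * (n - 2).descFactorial (t - 2)) := by
    intro X hX
    have := card_copyEmbeddings_le F G X (fun x hx => (hT x).1 (hX hx)) D r hD hdeg
    rwa [hV, ht] at this
  rcases T.eq_empty_or_nonempty with rfl | ⟨x, hx⟩
  · simpa using hU ∅ le_rfl
  obtain ⟨y, hxy⟩ := (hT x).1 hx
  have hT2 : 2 ≤ #T := one_lt_card.2 ⟨x, hx, y, (hT y).2 ⟨x, hxy.symm⟩, hxy.ne⟩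
  have hdt : d * #T ≤ d * t := Nat.mul_le_mul_left d hTt
  have hd2 : d ≤ d * t := Nat.le_mul_of_pos_right d (by lia)
  have hn' : 4 * (d * t) + 3 * d ^ 2 + 5 * t ≤ n := by rwa [← mul_assoc]
  have hlow := Nat.three_mul_descFactorial_le n d #T t hTt (by lia) (by lia) (by lia)
  -- The set `X` has two elements for `r ≥ n / 6`, is all of `T` for `r ≤ n / (2 * #T)`, and has `⌈n
  -- / (2 * r)⌉` elements in between.
  rcases le_or_gt n (6 * r) with h6 | h6
  · obtain ⟨X, hXT, hX⟩ := exists_subset_card_eq hT2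
    have h1 := hU X hXT
    have h2 := Nat.descFactorial_bound_of_large n r (t - 2) h6 hrn
    rw [show t - 2 + 2 = t by lia] at h2
    rw [hX] at h1
    lia
  rcases le_or_gt (2 * (r * #T)) n with hs | hs
  · obtain ⟨k, hk⟩ : ∃ k, #T = k + 2 := ⟨#T - 2, by lia⟩
    have h1 := hU T le_rfl
    have h2 := Nat.descFactorial_bound_of_small n d r k hdr (by rwa [← hk])
      (by rw [← hk, mul_assoc]; lia)
    -- Splitting off the isolated vertices of `F` leaves a common factor, so the small bound is only
    -- needed for `#T` vertices.
    have h3 : (n - 2).descFactorial (t - 2) =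
        (n - 2).descFactorial k * (n - #T).descFactorial (t - #T) := by
      rw [← Nat.descFactorial_mul_descFactorial (show k ≤ t - 2 by lia), mul_comm,
        show n - 2 - k = n - #T by lia, show t - 2 - k = t - #T by lia]
    rw [h3] at h1
    rw [← hk] at h2
    refine h1.trans (le_trans (le_of_eq ?_)
      (Nat.mul_le_mul_right ((n - #T).descFactorial (t - #T)) h2))
    ring
  · obtain ⟨m, hm1, hm2⟩ : ∃ m, n ≤ 2 * (r * m) ∧ 2 * (r * m) < n + 2 * r := by
      refine ⟨(n + 2 * r - 1) / (2 * r), ?_, ?_⟩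
      · have := Nat.lt_div_mul_add (a := n + 2 * r - 1) (show 0 < 2 * r by lia)
        lia
      · have := Nat.div_mul_le_self (n + 2 * r - 1) (2 * r)
        lia
    have hm2' : 2 ≤ m := by
      by_contra! hc
      have : r * m ≤ r * 1 := Nat.mul_le_mul_left r (by lia)
      lia
    have hmT : m ≤ #T := by
      by_contra! hc
      have : r * (#T + 1) ≤ r * m := Nat.mul_le_mul_left r hc
      lia
    obtain ⟨X, hXT, hX⟩ := exists_subset_card_eq hmT
    have h1 := hU X hXT
    have h2 := Nat.descFactorial_bound_of_medium n r m t (by lia) h6.le hm2' (hmT.trans hTt) hm1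
      hm2.le
    rw [hX] at h1
    lia

theorem clique_le_card_copyEmbeddings_extremalGraph (F : SimpleGraph W) {n d t : ℕ} (hdn : d ≤ n)
    (ht : Fintype.card W = t) {T : Finset W} (hT : ∀ x, x ∈ T ↔ ∃ y, F.Adj x y) :
    (n - d).descFactorial #T * (n - #T).descFactorial (t - #T) ≤
      #(copyEmbeddings F (extremalGraph n d)) := by
  have h := le_card_copyEmbeddings F (extremalGraph n d) T (fun x y hxy => (hT x).2 ⟨y, hxy⟩)
    {v : Fin n | n ≤ (v : ℕ) + d} ?_
  · rwa [card_filter_fin_add_ge hdn, Fintype.card_fin, ht] at h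
  · intro u hu v hv huv
    simp only [mem_filter, mem_univ, true_and, not_le] at hu hv
    exact ⟨huv, Or.inl ⟨hu, hv⟩⟩

/-- The structure of nonhamiltonian graphs violating Chvátal's condition only at the minimum
degree: `d` vertices of degree `d` with the same neighbours outside their set `D`, attached to a
clique. -/
theorem card_copyEmbeddings_le_of_ore (F : SimpleGraph W) (G : SimpleGraph V) [DecidableRel G.Adj]
    {n d t : ℕ} (hV : Fintype.card V = n) (ht : Fintype.card W = t) (ht1 : 1 ≤ t) (hd : 1 ≤ d)
    (hn : 4 * d * t + 3 * d ^ 2 + 5 * t ≤ n)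
    (hore : ∀ u v, u ≠ v → ¬ G.Adj u v → G.degree u + G.degree v < n)
    (hcomp : ∃ u v, u ≠ v ∧ ¬ G.Adj u v) (hdeg : ∀ v, d ≤ G.degree v) :
    #(copyEmbeddings F G) ≤ #(copyEmbeddings F (extremalGraph n d)) := by
  classical
  have hd2 : d ≤ d * t := Nat.le_mul_of_pos_right d (by lia)
  have hn' : 4 * (d * t) + 3 * d ^ 2 + 5 * t ≤ n := by rwa [← mul_assoc]
  by_cases hA : ∃ r, d + 1 ≤ r ∧ 2 * r < n ∧ r ≤ #{v | G.degree v ≤ r}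
  · obtain ⟨r, hdr, hrn, hr⟩ := hA
    have hT : ∀ x, x ∈ ({x | ∃ y, F.Adj x y} : Finset W) ↔ ∃ y, F.Adj x y := by simp
    exact (card_copyEmbeddings_le_of_card_degree_le F G hV ht hd hn hdr hrn hr hT).trans
      (clique_le_card_copyEmbeddings_extremalGraph F (by lia) ht hT)
  push Not at hA
  rw [← hV] at hore
  let D : Finset V := {v | G.degree v ≤ d}
  -- The failure of the condition at `r = d + 1` also rules out degree `d + 1`, leaving degree at
  -- least `d + 2` outside `D`.
  have hDle : #({v | G.degree v ≤ d + 1} : Finset V) ≤ d := by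
    have := hA (d + 1) le_rfl (by lia)
    lia
  have hDge : d ≤ #D := by
    obtain ⟨u, v, huv, hadj⟩ := hcomp
    obtain ⟨w, -, hw, hcard⟩ := exists_degree_le_card_filter G hore ∅ (by simp)
      ⟨u, by simp, v, by simp, huv, hadj⟩
    rw [hV] at hw
    have hwd : G.degree w = d := by
      by_contra hne
      have := hA (G.degree w) (by have := hdeg w; lia) hw
      lia
    rwa [hwd] at hcard
  have hsub : D ⊆ ({v | G.degree v ≤ d + 1} : Finset V) :=
    fun v hv => mem_filter.2 ⟨mem_univ _, (mem_filter.1 hv).2.trans (Nat.le_succ d)⟩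
  have hDcard : #D = d := le_antisymm ((card_le_card hsub).trans hDle) hDge
  have hDeq := eq_of_subset_of_card_le hsub (hDle.trans hDge)
  have hDdeg : ∀ v ∈ D, G.degree v = d := fun v hv => le_antisymm (mem_filter.1 hv).2 (hdeg v)
  have hout : ∀ v ∉ D, d + 1 < G.degree v := by
    intro v hv
    by_contra! hc
    exact hv (hDeq ▸ mem_filter.2 ⟨mem_univ _, hc⟩)
  have hclique : ∀ u ∉ D, ∀ v ∉ D, u ≠ v → G.Adj u v := by
    by_contra! hc
    obtain ⟨w, hwD, hw, hcard⟩ := exists_degree_le_card_filter G hore D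
      (fun z hz v hv => by rw [hDdeg z hz]; have := hout v hv; lia) hc
    rw [hV] at hw
    have := hA (G.degree w) (by have := hout w hwD; lia) hw
    lia
  have hDc : #Dᶜ = n - d := by rw [card_compl, hV, hDcard]
  -- A vertex `a` of the clique with a neighbour in `D` has degree at least `n - d`, so a
  -- non-neighbour in `D`, of degree `d`, would violate the degree-sum bound.
  have hjoin : ∀ a ∉ D, ∀ v ∈ D, G.Adj v a → ∀ w ∈ D, G.Adj w a := by
    intro a ha v hv hva w hw
    by_contra hwa
    have hne : w ≠ a := fun h => ha (h ▸ hw)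
    have h1 := hore w a hne hwa
    have h2 : insert v (Dᶜ.erase a) ⊆ G.neighborFinset a := by
      intro b hb
      rw [mem_neighborFinset]
      rcases mem_insert.1 hb with rfl | hb
      · exact hva.symm
      · rw [mem_erase, mem_compl] at hb
        exact hclique a ha b hb.2 hb.1.symm
    have h3 := card_le_card h2
    rw [card_insert_of_notMem (by simp [hv]), card_erase_of_mem (mem_compl.2 ha), hDc,
      card_neighborFinset_eq_degree] at h3
    rw [hDdeg w hw, hV] at h1
    lia
  obtain ⟨v₀, hv₀⟩ : D.Nonempty := card_pos.1 (by lia)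
  let B : Finset V := G.neighborFinset v₀ \ D
  have hBmem : ∀ a, a ∈ B ↔ G.Adj v₀ a ∧ a ∉ D := by simp [B]
  have hBD : B ⊆ Dᶜ := fun a ha => mem_compl.2 ((hBmem a).1 ha).2
  have hBcard : #B ≤ d := by
    rw [← hDdeg v₀ hv₀, ← card_neighborFinset_eq_degree]
    exact card_le_card sdiff_subset
  obtain ⟨S, hBS, hSD, hS⟩ := exists_subsuperset_card_eq hBD hBcard (by lia)
  have hdisj : Disjoint S D := Finset.disjoint_left.2 fun a ha => mem_compl.1 (hSD ha)
  obtain ⟨e⟩ := nonempty_iso_extremalGraph hV (by lia) D S hDcard hS hdisj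
  rw [← card_copyEmbeddings_iso F e]
  refine card_copyEmbeddings_le_cliqueWithTwins F G D S B hBS hdisj ?_ ?_ ?_ ?_
  · intro u hu a ha
    rw [mem_neighborFinset] at ha
    by_cases haD : a ∈ D
    · exact mem_union_right _ haD
    · exact mem_union_left _ ((hBmem a).2 ⟨hjoin a haD u hu ha v₀ hv₀, haD⟩)
  · intro u hu a ha
    rw [mem_neighborFinset]
    obtain ⟨h1, h2⟩ := (hBmem a).1 ha
    exact hjoin a h2 v₀ hv₀ h1 u hu
  · intro u hu
    rw [hDdeg u hu, hS]
  · rw [hDcard, ht, hV]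
    lia

end SimpleGraph

theorem theorem2p1 {W : Type*} [Fintype W] (F : SimpleGraph W)
    (t : ℕ) (ht : Fintype.card W = t) (ht3 : 3 ≤ t)
    (d : ℕ) (hd : 1 ≤ d)
    (n : ℕ) (hn : 4 * d * t + 3 * d ^ 2 + 5 * t ≤ n)
    {V : Type*} [Fintype V] [DecidableEq V] (G : SimpleGraph V) [DecidableRel G.Adj]
    (hV : Fintype.card V = n) (hG : ¬ G.IsHamiltonian) (hdeg : d ≤ G.minDegree) :
    G.labelledCopyCount F ≤ (extremalGraph n d).labelledCopyCount F := by
  classical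
  obtain ⟨G', hle, hmax⟩ := (Set.toFinite {G : SimpleGraph V | ¬ G.IsHamiltonian}).exists_le_maximal
    (show G ∈ {G : SimpleGraph V | ¬ G.IsHamiltonian} from hG)
  have hmax' : Maximal (fun G : SimpleGraph V => ¬ G.IsHamiltonian) G' := hmax
  have h3 : 3 ≤ Fintype.card V := by lia
  rw [SimpleGraph.labelledCopyCount_eq_card_copyEmbeddings, SimpleGraph.labelledCopyCount_eq_card_copyEmbeddings]
  refine (Finset.card_le_card (SimpleGraph.copyEmbeddings_mono F hle)).trans ?_
  refine SimpleGraph.card_copyEmbeddings_le_of_ore F G' hV ht (by lia) hd hn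
    (fun u v huv hadj => hV ▸ SimpleGraph.degree_add_degree_lt_of_maximal G' h3 hmax' huv hadj) ?_ ?_
  · by_contra! hc
    exact hmax'.prop (SimpleGraph.isHamiltonian_of_complete G' h3 hc)
  · intro v
    exact (hdeg.trans (G.minDegree_le_degree v)).trans (SimpleGraph.degree_le_of_le hle)
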